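/- Fix a finite signature all of whose relation symbols are unary or binary, and consider relational structures $R=(V,(\rho_i)_{i\in I})$ of this signature (binary structures). A \emph{module} of $R$ is a subset $A\subseteq V$ such that for all $a,a'\in A$, all $x\in V\setminus A$ and every binary relation $\rho_i$ one has $x\,\rho_i\,a\Leftrightarrow x\,\rho_i\,a'$ and $a\,\rho_i\,x\Leftrightarrow a'\,\rho_i\,x$. The structure $R$ is \emph{prime} if its only modules are $\varnothing$, the singletons $\{v\}$ with $v\in V$, and $V$. A structure $R$ \emph{embeds} in $R'$ if $R$ is isomorphic to an induced substructure of $R'$. A class $\mathcal C$ of finite structures is \emph{hereditary} if it contains every finite structure that embeds in a member of $\mathcal C$. A hereditary class $\mathcal C$ of finite structures is \emph{minimal prime} if it contains infinitely many prime structures, up to isomorphism, while every hereditary class properly contained in $\mathcal C$ contains only finitely many prime structures, up to isomorphism. The \emph{age} of a (possibly infinite) structure $R$ is the class of all finite structures that embed in $R$. \textbf{Theorem.} Let $\mathcal C$ be a minimal prime hereditary class of finite binary structures of a given finite signature. Then there is a prime structure $R$ of this signature whose age is $\mathcal C$. Furthermore, $\mathcal C$ is well-quasi-ordered by embeddability: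 for every infinite sequence $R_0,R_1,R_2,\dots$ of members of $\mathcal C$ there are $m<n$ such that $R_m$ embeds in $R_n$ (equivalently, every such sequence has an infinite subsequence that is increasing for embeddability). -/

import Mathlib

open CategoryTheory
open scoped FirstOrder

universe u v w

namespace BinaryStructure

/-- The relational language `L` is a signature of binary structures, and it is finite: every
relation symbol is unary or binary, and there are finitely many relation symbols. -/
structure IsFiniteBinary (L : FirstOrder.Language.{u, v}) [L.IsRelational] : Prop where
  arity : ∀ n, L.Relations n → n = 1 ∨ n = 2
  finite : Finite (Σ n, L.Relations n)

/-- A module of a binary structure: a set `A` such that no element outside of `A` distinguishes two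
elements of `A` by a binary relation. (A unary relation, identified with a set of loops `(u, u)`,
imposes no condition, since `x ∉ A` and `a ∈ A` are distinct.) -/
def IsModule (L : FirstOrder.Language.{u, v}) {V : Type w} [L.Structure V] (A : Set V) : Prop :=
  ∀ r : L.Relations 2, ∀ a ∈ A, ∀ a' ∈ A, ∀ x ∉ A,
    (FirstOrder.Language.Structure.RelMap r ![x, a] ↔
      FirstOrder.Language.Structure.RelMap r ![x, a']) ∧
    (FirstOrder.Language.Structure.RelMap r ![a, x] ↔
      FirstOrder.Language.Structure.RelMap r ![a', x])

/-- A binary structure is prime if its only modules are the trivial ones: the empty set, the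
singletons and the whole domain. -/
def IsPrimeStructure (L : FirstOrder.Language.{u, v}) (V : Type w) [L.Structure V] : Prop :=
  ∀ A : Set V, IsModule L A → A = ∅ ∨ (∃ a, A = {a}) ∨ A = Set.univ

/-- The set of isomorphism types of the prime structures that belong to the class `K`. -/
def primeTypes {L : FirstOrder.Language.{u, v}} (K : Set (Bundled.{w} L.Structure)) :
    Set (Quotient (FirstOrder.Language.equivSetoid (L := L))) :=
  Quotient.mk _ '' {M : Bundled.{w} L.Structure | M ∈ K ∧ IsPrimeStructure L M}

/-- A hereditary class of finite structures: every member is finite, and every finite structure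
that embeds into a member is a member. In particular the class is closed under isomorphism. -/
structure IsHereditaryClass {L : FirstOrder.Language.{u, v}}
    (K : Set (Bundled.{w} L.Structure)) : Prop where
  finite : ∀ M ∈ K, Finite M
  mem_of_embedding : ∀ M ∈ K, ∀ N : Bundled.{w} L.Structure, Finite N →
    Nonempty (N ↪[L] M) → N ∈ K

/-- A minimal prime class: a hereditary class of finite structures with infinitely many prime
members (up to isomorphism), each proper hereditary subclass of which has only finitely many. -/
structure IsMinimalPrime {L : FirstOrder.Language.{u, v}}
    (K : Set (Bundled.{w} L.Structure)) : Prop where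
  hereditary : IsHereditaryClass K
  infinite_primes : (primeTypes K).Infinite
  finite_primes : ∀ K' : Set (Bundled.{w} L.Structure), K' ⊂ K → IsHereditaryClass K' →
    (primeTypes K').Finite

/-- The age of a structure: the class of all finite structures that embed into it. -/
def age (L : FirstOrder.Language.{u, v}) (V : Type w) [L.Structure V] :
    Set (Bundled.{w} L.Structure) :=
  {N | Finite N ∧ Nonempty (N ↪[L] V)}

/-- For relational languages this is Mathlib's age. -/
theorem age_eq (L : FirstOrder.Language.{u, v}) [L.IsRelational] (V : Type w) [L.Structure V] :
    age L V = L.age V := by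
  ext N
  exact and_congr_left fun _ => FirstOrder.Language.Structure.fg_iff_finite.symm

end BinaryStructure

namespace BinaryStructure

open FirstOrder.Language FirstOrder.Language.Structure

/-! ### Induced substructures. -/

section Substructures

variable {L : FirstOrder.Language.{u, v}} [L.IsRelational] {V : Type w} [L.Structure V]

/-! A hereditary class with finitely many primes is well-quasi-ordered. In a minimal bad sequence
every term is a lexicographic sum over a prime induced on a transversal
(`exists_isModularRetraction`). One prime recurs infinitely often, the blocks lie in a
well-quasi-order because they are smaller, and Dickson's lemma over the finite prime gives blockwise
embeddings, which glue. In a minimal prime class, the tail of a bad sequence avoids its first term,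
so it lies in a proper hereditary subclass, which has finitely many primes: a contradiction. Hence
infinitely many primes contain an increasing chain. Its direct limit is prime, and by minimality its
age is the whole class. -/

theorem relMap_pair_iff {L : FirstOrder.Language.{u, v}} {V W : Type*} [L.Structure V]
    [L.Structure W] (e : V ↪[L] W) (r : L.Relations 2) (a b : V) :
    RelMap r ![e a, e b] ↔ RelMap r ![a, b] := by
  rw [← e.map_rel r ![a, b], show e ∘ ![a, b] = ![e a, e b] by ext i; fin_cases i <;> rfl]

/-- The substructure of a relational structure induced on a set. -/
def induced (L : FirstOrder.Language.{u, v}) [L.IsRelational] {V : Type w} [L.Structure V]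
    (s : Set V) : L.Substructure V :=
  ⟨s, fun f => isEmptyElim f⟩

theorem relMap_induced {s : Set V} (r : L.Relations 2) (a b : induced L s) :
    RelMap r ![a, b] ↔ RelMap r ![(a : V), (b : V)] :=
  (relMap_pair_iff (induced L s).subtype r a b).symm

theorem finite_induced [Finite V] (s : Set V) : Finite (induced L s) :=
  inferInstanceAs (Finite {x // x ∈ induced L s})

end Substructures

section Modules

variable {L : FirstOrder.Language.{u, v}} {V W : Type w} [L.Structure V] [L.Structure W]

theorem IsModule.preimage {A : Set W} (hA : IsModule L A) (e : V ↪[L] W) :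
    IsModule L (e ⁻¹' A) := by
  intro r a ha a' ha' x hx
  have h := hA r (e a) ha (e a') ha' (e x) hx
  simpa only [relMap_pair_iff] using h

theorem isPrimeStructure_iff : IsPrimeStructure L V ↔
    ∀ A : Set V, IsModule L A → A.Nontrivial → A = Set.univ := by
  refine forall_congr' fun A => imp_congr_right fun _ => ?_
  rw [← or_assoc, ← Set.not_nontrivial_iff.trans Set.subsingleton_iff_eq_empty_or_singleton,
    imp_iff_not_or]

end Modules

/-! ### Lexicographic decomposition over a prime transversal. -/

section Congruences

variable {L : FirstOrder.Language.{u, v}} {V : Type w} [L.Structure V]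

/-- A map choosing a representative in each block of a partition into modules. -/
structure IsModularRetraction (L : FirstOrder.Language.{u, v}) {V : Type w} [L.Structure V]
    (q : V → V) : Prop where
  idem : ∀ x, q (q x) = q x
  rel : ∀ (r : L.Relations 2) (x y : V), q x ≠ q y →
    (RelMap r ![x, y] ↔ RelMap r ![q x, q y])

theorem isModularRetraction_id : IsModularRetraction L (id : V → V) :=
  ⟨fun _ => rfl, fun _ _ _ _ => Iff.rfl⟩

/-- Merging the blocks that correspond to a module of the quotient. -/
theorem IsModularRetraction.merge [L.IsRelational] {q : V → V} (hq : IsModularRetraction L q)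
    {A : Set (induced L (Set.range q))} (hA : IsModule L A) {a : induced L (Set.range q)}
    (ha : a ∈ A) {p : V → V}
    (hp : ∀ x, (⟨q x, x, rfl⟩ : induced L (Set.range q)) ∈ A → p x = a)
    (hp' : ∀ x, (⟨q x, x, rfl⟩ : induced L (Set.range q)) ∉ A → p x = q x) :
    IsModularRetraction L p := by
  let c : V → induced L (Set.range q) := fun x => ⟨q x, x, rfl⟩
  have hcc : ∀ x, c (q x) = c x := fun x => Subtype.ext (hq.idem x)
  have hca : c a = a := by
    obtain ⟨_, y, rfl⟩ := a
    exact hcc y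
  refine ⟨fun x => ?_, fun r x y hxy => ?_⟩
  · by_cases hx : c x ∈ A
    · rw [hp x hx, hp _ (by change c a ∈ A; rwa [hca])]
    · rw [hp' x hx, hp' _ (by change c (q x) ∉ A; rwa [hcc]), hq.idem]
  · by_cases hx : c x ∈ A <;> by_cases hy : c y ∈ A
    · exact absurd ((hp x hx).trans (hp y hy).symm) hxy
    · rw [hp x hx, hp' y hy, hq.rel r x y (fun h => hy (by
        rwa [show c y = c x from Subtype.ext h.symm]))]
      have := (hA r (c x) hx a ha (c y) hy).2
      rwa [relMap_induced, relMap_induced] at this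
    · rw [hp' x hx, hp y hy, hq.rel r x y (fun h => hx (by
        rwa [show c x = c y from Subtype.ext h]))]
      have := (hA r (c y) hy a ha (c x) hx).1
      rwa [relMap_induced, relMap_induced] at this
    · rw [hp' x hx, hp' y hy] at hxy ⊢
      exact hq.rel r x y hxy

/-- Every finite structure is a lexicographic sum over a prime structure, of proper substructures
if it has at least two elements. -/
theorem exists_isModularRetraction [L.IsRelational] [Finite V] :
    ∃ q : V → V, IsModularRetraction L q ∧ IsPrimeStructure L (induced L (Set.range q)) ∧
      (Nontrivial V → (Set.range q).Nontrivial) := by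
  classical
  rcases subsingleton_or_nontrivial V with hV | hV
  · exact ⟨id, isModularRetraction_id, isPrimeStructure_iff.2 fun A _ ⟨a, _, b, _, hab⟩ =>
      absurd (Subtype.ext (Subsingleton.elim (a : V) b)) hab, fun h => (not_nontrivial V h).elim⟩
  -- Take the coarsest partition with at least two blocks: a nontrivial proper module of its
  -- quotient could be merged into one block.
  obtain ⟨q, ⟨hq, hnt⟩, hmin⟩ := exists_minimalFor_of_wellFoundedLT
    (fun q : V → V => IsModularRetraction L q ∧ (Set.range q).Nontrivial)
    (fun q => (Set.range q).ncard) ⟨id, isModularRetraction_id, by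
      rw [Set.range_id]; exact Set.nontrivial_univ⟩
  refine ⟨q, hq, isPrimeStructure_iff.2 fun A hA ⟨a, ha, b, hb, hab⟩ => ?_, fun _ => hnt⟩
  by_contra hne
  obtain ⟨d, hd⟩ := (Set.ne_univ_iff_exists_notMem A).1 hne
  let p : V → V := fun x =>
    if (⟨q x, x, rfl⟩ : induced L (Set.range q)) ∈ A then a else q x
  have hp := hq.merge hA ha (p := p) (fun x hx => if_pos hx) (fun x hx => if_neg hx)
  have hfix : ∀ t : induced L (Set.range q),
      (⟨q t, t, rfl⟩ : induced L (Set.range q)) = t := by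
    rintro ⟨_, y, rfl⟩
    exact Subtype.ext (hq.idem y)
  have hpa : p a = a := if_pos (by rwa [hfix])
  have hpd : p d = d := (if_neg (by rwa [hfix])).trans (congrArg Subtype.val (hfix d))
  have hsub : Set.range p ⊆ Set.range q := by
    rintro _ ⟨x, rfl⟩
    by_cases hx : (⟨q x, x, rfl⟩ : induced L (Set.range q)) ∈ A
    · rw [show p x = a from if_pos hx]
      exact a.2
    · exact ⟨x, (if_neg hx : p x = q x).symm⟩
  -- Merging loses `b`, while `a` and `d` keep the range nontrivial.
  have hbp : (b : V) ∉ Set.range p := by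
    rintro ⟨x, hx⟩
    by_cases hxA : (⟨q x, x, rfl⟩ : induced L (Set.range q)) ∈ A
    · exact hab (Subtype.ext ((if_pos hxA : p x = a).symm.trans hx))
    · exact hxA ((Subtype.ext ((if_neg hxA : p x = q x).symm.trans hx) :
        (⟨q x, x, rfl⟩ : induced L (Set.range q)) = b) ▸ hb)
  have hlt : (Set.range p).ncard < (Set.range q).ncard :=
    Set.ncard_lt_ncard ⟨hsub, fun h => hbp (h b.2)⟩ (Set.toFinite _)
  exact absurd (hmin ⟨hp, a, ⟨a, hpa⟩, d, ⟨d, hpd⟩, fun h => hd (Subtype.ext h ▸ ha)⟩ hlt.le)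
    hlt.not_ge

/-- Embeddings between corresponding blocks of two lexicographic sums yield an embedding. -/
theorem IsModularRetraction.nonempty_embedding [L.IsRelational] (hL : IsFiniteBinary L)
    {W : Type w} [L.Structure W] {p : V → V} {q : W → W}
    (hp : IsModularRetraction L p) (hq : IsModularRetraction L q)
    (e : induced L (Set.range p) ↪[L] induced L (Set.range q))
    (h : ∀ t : induced L (Set.range p),
      Nonempty (induced L (p ⁻¹' {(t : V)}) ↪[L] induced L (q ⁻¹' {(e t : W)}))) :
    Nonempty (V ↪[L] W) := by
  let E := fun t => (h t).some
  let c : V → induced L (Set.range p) := fun x => ⟨p x, x, rfl⟩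
  let g : V → W := fun x => E (c x) ⟨x, rfl⟩
  have hg : ∀ (t : induced L (Set.range p)) (x : V) (hx : x ∈ induced L (p ⁻¹' {(t : V)})),
      g x = E t ⟨x, hx⟩ := by
    intro t x hx
    obtain rfl : c x = t := Subtype.ext hx
    rfl
  have hqg : ∀ x, q (g x) = e (c x) := fun x => (E (c x) ⟨x, rfl⟩).2
  have hinj : Function.Injective g := by
    intro x y hxy
    have hc : c x = c y := e.injective (Subtype.ext (by rw [← hqg, ← hqg, hxy]))
    have hy : y ∈ induced L (p ⁻¹' {(c x : V)}) := congrArg Subtype.val hc.symm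
    have hx : x ∈ induced L (p ⁻¹' {(c x : V)}) := rfl
    rw [hg (c x) x hx, hg (c x) y hy] at hxy
    exact congrArg Subtype.val ((E (c x)).injective (Subtype.ext hxy))
  -- Unary relations and loops are settled inside a block; only pairs across blocks use the
  -- quotient.
  have hblock : ∀ {n : ℕ} (r : L.Relations n) (x : Fin n → V) (t : induced L (Set.range p)),
      (∀ i, x i ∈ induced L (p ⁻¹' {(t : V)})) → (RelMap r (g ∘ x) ↔ RelMap r x) := by
    intro n r x t hx
    let y : Fin n → induced L (p ⁻¹' {(t : V)}) := fun i => ⟨x i, hx i⟩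
    have h1 : g ∘ x = (induced L (q ⁻¹' {(e t : W)})).subtype ∘ (E t ∘ y) :=
      funext fun i => hg t (x i) (hx i)
    have h2 : x = (induced L (p ⁻¹' {(t : V)})).subtype ∘ y := rfl
    rw [h1, Embedding.map_rel, Embedding.map_rel]
    conv_rhs => rw [h2, Embedding.map_rel]
  refine ⟨⟨⟨g, hinj⟩, fun f => isEmptyElim f, fun {n} r x => ?_⟩⟩
  change RelMap r (g ∘ x) ↔ RelMap r x
  obtain rfl | rfl := hL.arity n r
  · exact hblock r x (c (x 0)) fun i => by rw [Subsingleton.elim i 0]; rfl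
  · by_cases hx : p (x 0) = p (x 1)
    · refine hblock r x (c (x 0)) fun i => ?_
      fin_cases i
      · rfl
      · exact hx.symm
    · have hgx : q (g (x 0)) ≠ q (g (x 1)) := by
        rw [hqg, hqg]
        exact fun h => hx (congrArg Subtype.val (e.injective (Subtype.ext h)))
      have h1 : x = ![x 0, x 1] := by ext i; fin_cases i <;> rfl
      have h2 : g ∘ x = ![g (x 0), g (x 1)] := by ext i; fin_cases i <;> rfl
      rw [h2, hq.rel r _ _ hgx, hqg, hqg, ← relMap_induced]
      conv_rhs => rw [h1, hp.rel r _ _ hx]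
      rw [relMap_pair_iff, relMap_induced]

end Congruences

/-! ### Minimal bad sequences. -/

section WellQuasiOrder

/-- Nash-Williams' argument: a bad sequence of such elements, spliced onto an initial segment of
`f`, would contradict minimality. -/
theorem _root_.Set.PartiallyWellOrderedOn.of_isMinBadSeq {α : Type*} {r : α → α → Prop}
    [IsPreorder α r] {rk : α → ℕ} {s : Set α} {f : ℕ → α}
    (hf : Set.PartiallyWellOrderedOn.IsBadSeq r s f)
    (hmin : ∀ n, Set.PartiallyWellOrderedOn.IsMinBadSeq r rk s n f) :
    {a ∈ s | ∃ n, r a (f n) ∧ rk a < rk (f n)}.PartiallyWellOrderedOn r := by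
  rw [Set.PartiallyWellOrderedOn.iff_forall_not_isBadSeq]
  rintro g ⟨hgs, hg⟩
  choose k hk hrk using fun n => (hgs n).2
  -- With `k i` least, each later `g j` lies below a term of `f` beyond the kept segment, so no good
  -- pair crosses the splice.
  obtain ⟨i, hi⟩ : ∃ i, ∀ j, k i ≤ k j := ⟨Function.argmin k, fun j => Function.argmin_le k j⟩
  refine hmin (k i) (fun n => if n < k i then f n else g (i + (n - k i)))
    (fun m hm => (if_pos hm).symm) (by simpa using hrk i) ⟨fun n => ?_, fun m n hmn => ?_⟩
  · dsimp only
    split_ifs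
    exacts [hf.1 n, (hgs _).1]
  · dsimp only
    split_ifs with hm hn hn
    · exact hf.2 m n hmn
    · exact fun h => hf.2 m _ (hm.trans_le (hi _)) (_root_.trans h (hk _))
    · omega
    · exact hg _ _ (by omega)

variable {L : FirstOrder.Language.{u, v}}

/-- Embeddability between structures. -/
def Embeds (M N : Bundled.{w} L.Structure) : Prop := Nonempty (M ↪[L] N)

instance : IsPreorder (Bundled.{w} L.Structure) Embeds where
  refl M := ⟨Embedding.refl L M⟩
  trans _ _ _ := fun ⟨e⟩ ⟨e'⟩ => ⟨e'.comp e⟩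

variable [L.IsRelational]

theorem card_block_lt {V : Type w} [L.Structure V] [Finite V] {q : V → V}
    (hq : (Set.range q).Nontrivial) (t : V) : Nat.card (induced L (q ⁻¹' {t})) < Nat.card V := by
  obtain ⟨_, ⟨y, rfl⟩, hy⟩ := hq.exists_ne t
  exact Finite.card_subtype_lt (p := fun x => x ∈ induced L (q ⁻¹' {t})) (x := y) hy

theorem IsHereditaryClass.induced_mem {K : Set (Bundled.{w} L.Structure)}
    (hK : IsHereditaryClass K) {M : Bundled.{w} L.Structure} (hM : M ∈ K) (s : Set M) :
    Bundled.of (c := L.Structure) (induced L s) ∈ K :=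
  have := hK.finite M hM
  hK.mem_of_embedding M hM _ (finite_induced s) ⟨(induced L s).subtype⟩

/-- A hereditary class of finite binary structures with finitely many primes is
well-quasi-ordered by embeddability. -/
theorem IsHereditaryClass.partiallyWellOrderedOn (hL : IsFiniteBinary L)
    {K : Set (Bundled.{w} L.Structure)} (hK : IsHereditaryClass K)
    (hfin : (primeTypes K).Finite) : K.PartiallyWellOrderedOn Embeds := by
  refine (Set.PartiallyWellOrderedOn.iff_not_exists_isMinBadSeq
    (fun M : Bundled.{w} L.Structure => Nat.card M)).2 ?_
  rintro ⟨f, hf, hmin⟩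
  have hsmall := Set.PartiallyWellOrderedOn.of_isMinBadSeq hf hmin
  have hfinite : ∀ n, Finite (f n) := fun n => hK.finite _ (hf.1 n)
  choose q hq hprime hnt using fun n => exists_isModularRetraction (L := L) (V := f n)
  obtain ⟨g, hg⟩ := (hfin.partiallyWellOrderedOn (r := (· = ·))).exists_monotone_subseq
    (f := fun n => Quotient.mk _ (Bundled.of (c := L.Structure) (induced L (Set.range (q n)))))
    (fun n => ⟨_, ⟨hK.induced_mem (hf.1 n) _, hprime n⟩, rfl⟩)
  have e : ∀ n, induced L (Set.range (q (g 0))) ≃[L] induced L (Set.range (q (g n))) :=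
    fun n => (Quotient.exact (hg 0 n n.zero_le)).some
  -- A one-point term has no smaller blocks, but it equals its own transversal.
  rcases subsingleton_or_nontrivial (f (g 0)) with hs | hn
  · refine hf.2 (g 0) (g 1) (g.strictMono one_pos) ⟨?_⟩
    have i : f (g 0) ↪[L] induced L (Set.range (q (g 0))) :=
      (Embedding.refl L _).codRestrict _ fun x => ⟨x, Subsingleton.elim _ _⟩
    exact (Substructure.subtype _).comp ((e 1).toEmbedding.comp i)
  · have hnt' : ∀ n, (Set.range (q (g n))).Nontrivial := fun n => by
      have : Nontrivial (induced L (Set.range (q (g 0)))) := (hnt (g 0) hn).coe_sort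
      exact Set.nontrivial_coe_sort.1 (e n).injective.nontrivial
    have : Finite (induced L (Set.range (q (g 0)))) := finite_induced _
    obtain ⟨m, n, hmn, h⟩ := (Set.PartiallyWellOrderedOn.pi
      fun _ : induced L (Set.range (q (g 0))) => hsmall).exists_lt
      (f := fun n t => Bundled.of (c := L.Structure)
        (induced L (q (g n) ⁻¹' {(e n t : f (g n))})))
      fun n t _ => ⟨hK.induced_mem (hf.1 _) _, g n, ⟨Substructure.subtype _⟩,
        card_block_lt (hnt' n) _⟩
    refine hf.2 (g m) (g n) (g.strictMono hmn)
      ((hq (g m)).nonempty_embedding hL (hq (g n)) ((e n).comp (e m).symm).toEmbedding fun t => ?_)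
    obtain ⟨t, rfl⟩ := (e m).surjective t
    have : ((e n).comp (e m).symm).toEmbedding (e m t) = e n t := by simp
    rw [this]
    exact h t

/-- A minimal prime class of finite binary structures is well-quasi-ordered by embeddability. -/
theorem IsMinimalPrime.wellQuasiOrdered (hL : IsFiniteBinary L)
    {K : Set (Bundled.{w} L.Structure)} (hK : IsMinimalPrime K) :
    WellQuasiOrdered (fun M N : K => Embeds M.1 N.1) := by
  intro f
  by_contra! hbad
  let K' : Set (Bundled.{w} L.Structure) := {N ∈ K | ¬ Embeds (f 0).1 N}
  have hK' : IsHereditaryClass K' :=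
    ⟨fun M hM => hK.hereditary.finite M hM.1, fun M hM N hN e =>
      ⟨hK.hereditary.mem_of_embedding M hM.1 N hN e, fun h => hM.2 (_root_.trans h e)⟩⟩
  have hss : K' ⊂ K := ⟨fun N hN => hN.1, fun h => (h (f 0).2).2 (refl _)⟩
  obtain ⟨m, n, hmn, h⟩ := (hK'.partiallyWellOrderedOn hL (hK.finite_primes K' hss hK')).exists_lt
    (f := fun n => (f (n + 1)).1) fun n => ⟨(f (n + 1)).2, hbad 0 (n + 1) n.succ_pos⟩
  exact hbad (m + 1) (n + 1) (by omega) h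

end WellQuasiOrder

/-! ### Primality and age of the limit of a chain. -/

section DirectLimits

variable {L : FirstOrder.Language.{u, v}}

/-- Two points of a module and any third point already occur in one prime stage, where the module's
trace must be everything. -/
theorem isPrimeStructure_directLimit (G : ℕ → Type w) [∀ i, L.Structure (G i)]
    (f : ∀ i j, i ≤ j → G i ↪[L] G j) [DirectedSystem G fun i j h => f i j h]
    (h : ∀ i, IsPrimeStructure L (G i)) :
    IsPrimeStructure L (FirstOrder.Language.DirectLimit G f) := by
  rw [isPrimeStructure_iff]
  rintro A hA ⟨a, ha, b, hb, hab⟩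
  refine Set.eq_univ_of_forall fun x => ?_
  have key : ∀ z : FirstOrder.Language.DirectLimit G f, ∃ i, ∀ j, i ≤ j →
      ∃ y, FirstOrder.Language.DirectLimit.of L ℕ G f j y = z := by
    intro z
    obtain ⟨i, y, rfl⟩ := FirstOrder.Language.DirectLimit.exists_of z
    exact ⟨i, fun j hj => ⟨f i j hj y, FirstOrder.Language.DirectLimit.of_f⟩⟩
  obtain ⟨i, hi⟩ := key a
  obtain ⟨j, hj⟩ := key b
  obtain ⟨k, hk⟩ := key x
  obtain ⟨a, rfl⟩ := hi (i + j + k) (by omega)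
  obtain ⟨b, rfl⟩ := hj (i + j + k) (by omega)
  obtain ⟨x, rfl⟩ := hk (i + j + k) (by omega)
  have := isPrimeStructure_iff.1 (h (i + j + k)) _
    (hA.preimage (FirstOrder.Language.DirectLimit.of L ℕ G f _))
    ⟨a, ha, b, hb, fun h => hab (h ▸ rfl)⟩
  exact this.ge (Set.mem_univ x)

theorem isHereditaryClass_age (V : Type w) [L.Structure V] : IsHereditaryClass (age L V) :=
  ⟨fun _ hM => hM.1, fun _ hM _ hN ⟨e⟩ => ⟨hN, hM.2.map fun e' => e'.comp e⟩⟩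

/-- A minimal prime class that is well-quasi-ordered is the age of a prime structure. -/
theorem IsMinimalPrime.exists_eq_age [L.IsRelational] {K : Set (Bundled.{w} L.Structure)}
    (hK : IsMinimalPrime K) (hwqo : WellQuasiOrdered (fun M N : K => Embeds M.1 N.1)) :
    ∃ R : Bundled.{w} L.Structure, IsPrimeStructure L R ∧ K = age L R := by
  let ι := hK.infinite_primes.natEmbedding
  choose M hM hMι using fun n => (ι n).2
  obtain ⟨g, hg⟩ := Set.PartiallyWellOrderedOn.exists_monotone_subseq (s := K) (r := Embeds)
    hwqo (f := M) fun n => (hM n).1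
  let E : ∀ n, M (g n) ↪[L] M (g (n + 1)) := fun n => (hg n (n + 1) n.le_succ).some
  let R := FirstOrder.Language.DirectLimit (fun n => M (g n)) (DirectedSystem.natLERec E)
  have hR : age L R = ⋃ n, age L (M (g n)) := by
    rw [age_eq]
    simp only [age_eq]
    exact age_directLimit _ _
  refine ⟨Bundled.of R, isPrimeStructure_directLimit _ _ fun n => (hM (g n)).2, ?_⟩
  have hsub : age L R ⊆ K := by
    rw [hR]
    exact Set.iUnion_subset fun n N hN =>
      hK.hereditary.mem_of_embedding _ (hM (g n)).1 N hN.1 hN.2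
  by_contra hne
  refine Set.infinite_of_injective_forall_mem (f := fun n => ((ι (g n)) : Quotient _))
    (fun m n h => g.injective (ι.injective (Subtype.ext h))) (fun n => ?_)
    (hK.finite_primes _ (hsub.ssubset_of_ne (Ne.symm hne)) (isHereditaryClass_age R))
  refine ⟨M (g n), ⟨?_, (hM (g n)).2⟩, hMι (g n)⟩
  rw [hR]
  exact Set.mem_iUnion.2 ⟨n, hK.hereditary.finite _ (hM (g n)).1, ⟨Embedding.refl L _⟩⟩

end DirectLimits

end BinaryStructure

theorem mainTheorem5 (L : FirstOrder.Language.{u, v}) [L.IsRelational]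
    (hL : BinaryStructure.IsFiniteBinary L)
    (K : Set (Bundled.{w} L.Structure)) (hK : BinaryStructure.IsMinimalPrime K) :
    (∃ R : Bundled.{w} L.Structure,
      BinaryStructure.IsPrimeStructure L R ∧ K = BinaryStructure.age L R) ∧
      WellQuasiOrdered (fun M N : K => Nonempty (M.1 ↪[L] N.1)) :=
  ⟨hK.exists_eq_age (hK.wellQuasiOrdered hL), hK.wellQuasiOrdered hL⟩
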